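/- Let $n\ge 0$ be an integer and $\delta\ge 0$ a real number. A metric space $\mathcal H$, with distance $|p-q|$, is called $\delta$-hyperbolic if any two of its points are joined by a geodesic segment and all its geodesic triangles are $\delta$-thin: whenever $p(t)$ and $q(t)$ are geodesic segments, parametrized by arc length, from a point $r$ to points $p$ and $q$ respectively, one has $|p(t)-q(t)|\le\delta$ for all $0\le t\le\langle p,q\rangle_r:=\tfrac12\left(|p-r|+|q-r|-|p-q|\right)$. The minimal displacement of an isometric action of a group $G$ on $\mathcal H$ is $\inf\{|g\cdot p-p| : g\in G\setminus\{1\},\ p\in\mathcal H\}$ (which is $+\infty$ if $G$ is trivial). **Theorem.** Let $G$ be a group that satisfies $\mathcal H_{n,\delta}$: $G$ acts by isometries on a nonempty $\delta$-hyperbolic metric space $\mathcal H$ with minimal displacement greater than $(2n+11)^2\delta$. Let $F$ be a free $\mathbb Z[G]$-module (of arbitrary rank), and let $M\subseteq F$ be a $\mathbb Z[G]$-submodule that is generated by $n$ elements and such that the quotient $F/M$ is torsion-free as an abelian group. Then $M$ is a free $\mathbb Z[G]$-module. -/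

import Mathlib

namespace HypAct

/-- `γ`, restricted to `[0, dist x y]`, is a geodesic segment from `x` to `y`, parametrized by arc
length. -/
def IsGeodesicSegment {H : Type*} [MetricSpace H] (γ : ℝ → H) (x y : H) : Prop :=
  γ 0 = x ∧ γ (dist x y) = y ∧
    ∀ s ∈ Set.Icc 0 (dist x y), ∀ t ∈ Set.Icc 0 (dist x y), dist (γ s) (γ t) = |s - t|

/-- The Gromov product `⟨p, q⟩_r`. -/
noncomputable def gromovProduct {H : Type*} [MetricSpace H] (p q r : H) : ℝ :=
  (dist p r + dist q r - dist p q) / 2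

/-- A metric space is `δ`-hyperbolic if it is geodesic and all its geodesic triangles are `δ`-thin:
two sides issuing from a common vertex `r` remain `δ`-close until time `⟨p, q⟩_r`, where `p` and `q`
are the other two vertices. -/
structure IsHyperbolic (H : Type*) [MetricSpace H] (δ : ℝ) : Prop where
  exists_geodesic : ∀ x y : H, ∃ γ : ℝ → H, IsGeodesicSegment γ x y
  thin : ∀ (r p q : H) (γ₁ γ₂ : ℝ → H), IsGeodesicSegment γ₁ r p → IsGeodesicSegment γ₂ r q →
    ∀ t : ℝ, 0 ≤ t → t ≤ gromovProduct p q r → dist (γ₁ t) (γ₂ t) ≤ δ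

/-- The minimal displacement of an action of `G` on `H`: the infimum of the distances `|g • p - p|`
over all `g ≠ 1` in `G` and all points `p` of `H` (it is `∞` for the trivial group). -/
noncomputable def minimalDisplacement (G H : Type*) [Group G] [MetricSpace H] [MulAction G H] :
    ENNReal :=
  ⨅ (g : G) (_ : g ≠ 1) (p : H), edist (g • p) p

end HypAct

/-! Over a field `k`, take a nontrivial relation `∑ a i • x i = 0` in a free `k[G]`-module and
expand it into terms `g • x i` with scalars. Through an orbit, each term's support becomes a finite
subset of the hyperbolic space, lying in a ball of about half its diameter; balls of distinct terms
with the same `i` have centres more than `ρ` apart. Looking from a base point at the terms that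
reach farthest out, `exists_cut` splits the relation into two parts that meet only in a ball smaller
than that of a term `t` occurring once of its kind. The partial sum over one part is minus the sum
over the other, so its support lies in this overlap. Normalized, it is `x t` plus a combination of
the other `x i`, with smaller diameter (`exists_smaller`). Descent on the diameters then produces a
zero member by transvections (`exists_reflTransGen_step_eq_zero`).

Over `ℤ`, the result for `ℚ` and clearing denominators give an independent family in `M` whose span
contains `K • M`. If the span is not closed under division by a prime `p`, the family is dependent
mod `p`; transvections over `𝔽_p[G]` lift to `ℤ[G]` and make one member divisible by `p`, with
quotient in `M` because `F / M` is torsion-free. Each such division lowers an integer determinant,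
obtained through the augmentation, so the process ends with a basis. -/

namespace HypAct

/-! ### Thin triangles, Gromov products and approximate centres. -/

section Hyperbolic

variable {H : Type*} [MetricSpace H] {δ : ℝ}

theorem IsHyperbolic.mono (h : IsHyperbolic H δ) {δ' : ℝ} (hle : δ ≤ δ') : IsHyperbolic H δ' where
  exists_geodesic := h.exists_geodesic
  thin r p q γ₁ γ₂ h₁ h₂ t h0 ht := (h.thin r p q γ₁ γ₂ h₁ h₂ t h0 ht).trans hle

theorem gromovProduct_comm (p q r : H) : gromovProduct p q r = gromovProduct q p r := by
  unfold gromovProduct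
  rw [dist_comm p q]
  ring

theorem gromovProduct_nonneg (p q r : H) : 0 ≤ gromovProduct p q r := by
  unfold gromovProduct
  have := dist_triangle p r q
  rw [dist_comm r q] at this
  linarith

theorem gromovProduct_le_left (p q r : H) : gromovProduct p q r ≤ dist r p := by
  unfold gromovProduct
  have := dist_triangle q p r
  rw [dist_comm r p]
  rw [dist_comm q p] at this
  linarith

theorem IsGeodesicSegment.dist_right {γ : ℝ → H} {x y : H} (h : IsGeodesicSegment γ x y) {t : ℝ}
    (h0 : 0 ≤ t) (ht : t ≤ dist x y) : dist (γ t) y = dist x y - t := by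
  have := h.2.2 t ⟨h0, ht⟩ (dist x y) ⟨dist_nonneg, le_rfl⟩
  rwa [h.2.1, abs_of_nonpos (by linarith), neg_sub] at this

theorem IsGeodesicSegment.symm {γ : ℝ → H} {x y : H} (h : IsGeodesicSegment γ x y) :
    IsGeodesicSegment (fun t => γ (dist x y - t)) y x := by
  refine ⟨by simpa using h.2.1, by simpa [dist_comm y x] using h.1, fun s hs t ht => ?_⟩
  rw [dist_comm y x] at hs ht
  rw [h.2.2 _ ⟨by linarith [hs.2], by linarith [hs.1]⟩ _ ⟨by linarith [ht.2], by linarith [ht.1]⟩,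
    abs_sub_comm]
  congr 1
  ring

/-- The four-point inequality for Gromov products. -/
theorem IsHyperbolic.min_gromovProduct_le (h : IsHyperbolic H δ) (x y z r : H) :
    min (gromovProduct x y r) (gromovProduct y z r) - δ ≤ gromovProduct x z r := by
  obtain ⟨α, hα⟩ := h.exists_geodesic r x
  obtain ⟨β, hβ⟩ := h.exists_geodesic r y
  obtain ⟨γ, hγ⟩ := h.exists_geodesic r z
  set t := min (gromovProduct x y r) (gromovProduct y z r) with ht
  have h0 : 0 ≤ t := le_min (gromovProduct_nonneg _ _ _) (gromovProduct_nonneg _ _ _)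
  have h1 : t ≤ gromovProduct x y r := min_le_left _ _
  have h2 : t ≤ gromovProduct y z r := min_le_right _ _
  have hx : t ≤ dist r x := h1.trans (gromovProduct_le_left _ _ _)
  have hz : t ≤ dist r z := h2.trans (by
    rw [gromovProduct_comm]; exact gromovProduct_le_left _ _ _)
  have d1 := h.thin r x y α β hα hβ t h0 h1
  have d2 := h.thin r y z β γ hβ hγ t h0 h2
  have e1 := hα.dist_right h0 hx
  have e2 := hγ.dist_right h0 hz
  have : dist x z ≤ dist x (α t) + dist (α t) (β t) + dist (β t) (γ t) + dist (γ t) z := by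
    linarith [dist_triangle x (α t) z, dist_triangle (α t) (β t) z, dist_triangle (β t) (γ t) z]
  rw [dist_comm x (α t)] at this
  unfold gromovProduct
  rw [dist_comm x r, dist_comm z r]
  linarith

/-- Distances to a point of a geodesic segment are controlled by the distances to its ends. -/
theorem IsHyperbolic.dist_geodesic_le (h : IsHyperbolic H δ) {γ : ℝ → H} {a b : H}
    (hγ : IsGeodesicSegment γ a b) {u : ℝ} (h0 : 0 ≤ u) (hu : u ≤ dist a b) (w : H) :
    dist w (γ u) ≤ max (dist w a - u) (dist w b - (dist a b - u)) + δ := by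
  have key : ∀ (γ : ℝ → H) (a b : H), IsGeodesicSegment γ a b → ∀ u, 0 ≤ u →
      u ≤ gromovProduct b w a → dist w (γ u) ≤ dist w a - u + δ := by
    intro γ a b hγ u h0 hu
    obtain ⟨β, hβ⟩ := h.exists_geodesic a w
    have d := h.thin a b w γ β hγ hβ u h0 hu
    have hw : u ≤ dist a w := hu.trans (by
      rw [gromovProduct_comm]; exact gromovProduct_le_left _ _ _)
    have e := hβ.dist_right h0 hw
    have := dist_triangle w (β u) (γ u)
    rw [dist_comm w (β u), dist_comm (β u) (γ u)] at this
    rw [dist_comm w a]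
    linarith
  -- The Gromov products based at `a` and at `b` add up to `dist a b`, so `key` applies from one of
  -- the two ends.
  rcases le_total u (gromovProduct b w a) with hc | hc
  · linarith [key γ a b hγ u h0 hc, le_max_left (dist w a - u) (dist w b - (dist a b - u))]
  · have hc' : dist a b - u ≤ gromovProduct a w b := by
      unfold gromovProduct at hc ⊢
      rw [dist_comm b a] at hc
      rw [dist_comm a w]
      rw [dist_comm b w] at hc
      linarith
    have := key _ b a hγ.symm (dist a b - u) (by linarith) hc'
    simp only [sub_sub_cancel] at this
    linarith [le_max_right (dist w a - u) (dist w b - (dist a b - u))]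

/-- A finite set lies in a ball whose radius is about half the diameter of the set. -/
theorem IsHyperbolic.exists_center (h : IsHyperbolic H δ) {S : Set H} (hf : S.Finite)
    (hne : S.Nonempty) : ∃ c, ∀ w ∈ S, dist w c ≤ Metric.diam S / 2 + δ := by
  obtain ⟨⟨a, b⟩, hab, hmax⟩ := (hf.prod hf).exists_maximalFor (fun z : H × H => dist z.1 z.2) _
    (hne.prod hne)
  have hle : ∀ x ∈ S, ∀ y ∈ S, dist x y ≤ dist a b := by
    intro x hx y hy
    rcases le_total (dist x y) (dist a b) with h | h
    · exact h
    · exact hmax (j := (x, y)) ⟨hx, hy⟩ h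
  have hdiam : dist a b ≤ Metric.diam S := Metric.dist_le_diam_of_mem hf.isBounded hab.1 hab.2
  obtain ⟨γ, hγ⟩ := h.exists_geodesic a b
  -- The centre is the midpoint of a pair realizing the diameter.
  refine ⟨γ (dist a b / 2), fun w hw => ?_⟩
  have := h.dist_geodesic_le hγ (u := dist a b / 2) (by positivity)
    (by linarith [dist_nonneg (x := a) (y := b)]) w
  have h1 := hle w hw a hab.1
  have h2 := hle w hw b hab.2
  have h3 : max (dist w a - dist a b / 2) (dist w b - (dist a b - dist a b / 2)) ≤
      dist a b / 2 := max_le (by linarith) (by linarith)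
  linarith

end Hyperbolic

/-! ### Chains reorganized by rank. -/

section Chains

variable {α : Type*}

/-- `RankedConn E rk m a b`: the points `a` and `b` are joined by an `E`-chain whose interior points
have rank less than `m`. -/
def RankedConn (E : α → α → Prop) (rk : α → ℕ) : ℕ → α → α → Prop
  | 0, a, b => E a b
  | m + 1, a, b => RankedConn E rk m a b ∨
      ∃ d, rk d = m ∧ RankedConn E rk m a d ∧ RankedConn E rk m d b

/-- If both chains pass through a point of top rank, `huniq` identifies these two points, and the
loop between them is dropped. -/
theorem RankedConn.trans {E : α → α → Prop} {rk : α → ℕ}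
    (huniq : ∀ m a b, rk a = m → rk b = m → RankedConn E rk m a b → a = b) :
    ∀ (m : ℕ) {a b d : α}, rk d < m → RankedConn E rk m a d → RankedConn E rk m d b →
      RankedConn E rk m a b := by
  intro m
  induction m with
  | zero => intro a b d hd; omega
  | succ m ih =>
    intro a b d hd h1 h2
    rcases Nat.lt_succ_iff_lt_or_eq.1 hd with hd | hd
    · rcases h1 with h1 | ⟨e, he, h1, h1'⟩ <;> rcases h2 with h2 | ⟨f, hf, h2, h2'⟩
      · exact Or.inl (ih hd h1 h2)
      · exact Or.inr ⟨f, hf, ih hd h1 h2, h2'⟩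
      · exact Or.inr ⟨e, he, h1, ih hd h1' h2⟩
      · obtain rfl := huniq m e f he hf (ih hd h1' h2)
        exact Or.inr ⟨e, he, h1, h2'⟩
    · have h1 : RankedConn E rk m a d := by
        rcases h1 with h1 | ⟨e, he, h1, h1'⟩
        · exact h1
        · rwa [huniq m e d he hd h1'] at h1
      have h2 : RankedConn E rk m d b := by
        rcases h2 with h2 | ⟨f, hf, h2, h2'⟩
        · exact h2
        · rwa [← huniq m d f hd hf h2] at h2'
      exact Or.inr ⟨d, hd, h1, h2⟩

theorem RankedConn.of_edge {E : α → α → Prop} {rk : α → ℕ} {a b : α} (h : E a b) :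
    ∀ m, RankedConn E rk m a b
  | 0 => h
  | m + 1 => Or.inl (RankedConn.of_edge h m)

/-- A chain of any length becomes one of nesting depth `m`, so iterating the four-point inequality
costs `m * δ`, independently of the length. -/
theorem RankedConn.of_reflTransGen {E : α → α → Prop} {rk : α → ℕ}
    (huniq : ∀ m a b, rk a = m → rk b = m → RankedConn E rk m a b → a = b) {m : ℕ}
    (hm : ∀ a, rk a < m) {a b : α} (h : Relation.ReflTransGen E a b) :
    a = b ∨ RankedConn E rk m a b := by
  induction h with
  | refl => exact Or.inl rfl
  | tail _ hE ih =>
    rcases ih with rfl | ih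
    · exact Or.inr (RankedConn.of_edge hE m)
    · exact Or.inr (RankedConn.trans huniq m (hm _) ih (RankedConn.of_edge hE m))

/-- An approximate ultrametric inequality loses one unit per rank along a ranked chain. -/
theorem RankedConn.le_of_edge {E : α → α → Prop} {rk : α → ℕ} {δ P : ℝ} {g : α → α → ℝ}
    (hδ : 0 ≤ δ) (hg : ∀ a b d, min (g a b) (g b d) - δ ≤ g a d) (U : Set α)
    (hE : ∀ a b, E a b → a ∈ U → b ∈ U → P ≤ g a b) :
    ∀ (m : ℕ) {a b : α}, (∀ d, rk d < m → d ∈ U) → a ∈ U → b ∈ U → RankedConn E rk m a b →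
      P - m * δ ≤ g a b := by
  intro m
  induction m with
  | zero => intro a b _ ha hb h; simpa using hE a b h ha hb
  | succ m ih =>
    intro a b hU ha hb h
    have hU' : ∀ d, rk d < m → d ∈ U := fun d hd => hU d (by omega)
    push_cast
    rcases h with h | ⟨d, hd, h1, h2⟩
    · linarith [ih hU' ha hb h]
    · have hdU : d ∈ U := hU d (by omega)
      have e1 := ih hU' ha hdU h1
      have e2 := ih hU' hdU hb h2
      linarith [hg a d b, le_min e1 e2]

end Chains

/-- A ranking of the indices by increasing value, with ties broken. -/
theorem exists_rank {m : ℕ} (s : Fin m → ℝ) :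
    ∃ e : Fin m → ℕ, Function.Injective e ∧ (∀ i, e i < m) ∧ ∀ i j, e i ≤ e j → s i ≤ s j := by
  refine ⟨fun i => ((Tuple.sort s).symm i : ℕ), fun i j hij => ?_, fun i => Fin.is_lt _,
    fun i j hij => ?_⟩
  · exact (Tuple.sort s).symm.injective (Fin.ext hij)
  · have := Tuple.monotone_sort s (Fin.le_def.2 hij)
    simpa using this

/-! ### Components of far-reaching balls and the cut. -/

section Components

variable {H : Type*} [MetricSpace H] {δ : ℝ} {α : Type*} {m : ℕ}

/-- Two indices are linked if their sets share a point at distance more than `t` from `q`. -/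
def FarLink (S : α → Set H) (q : H) (t : ℝ) (a b : α) : Prop :=
  ∃ w, w ∈ S a ∧ w ∈ S b ∧ t < dist q w

theorem FarLink.symm {S : α → Set H} {q : H} {t : ℝ} {a b : α} (h : FarLink S q t a b) :
    FarLink S q t b a :=
  let ⟨w, ha, hb, hw⟩ := h
  ⟨w, hb, ha, hw⟩

theorem FarLink.mono {S : α → Set H} {q : H} {t t' : ℝ} (htt : t' ≤ t) {a b : α}
    (h : FarLink S q t a b) : FarLink S q t' a b :=
  let ⟨w, ha, hb, hw⟩ := h
  ⟨w, ha, hb, htt.trans_lt hw⟩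

/-- The depth of the ball of centre `z` and radius `r` in the ball of centre `q` and radius `R`. -/
def slack (q z : H) (R r : ℝ) : ℝ := R - r - dist q z

variable {gen : α → Fin m} {c : α → H} {s : Fin m → ℝ} {S : α → Set H} {q : H} {R K ρ : ℝ}

/-- A ball containing a point near the sphere of radius `R` about `q` cannot lie deep inside it. -/
theorem FarLink.slack_le (hS : ∀ a, ∀ w ∈ S a, dist w (c a) ≤ s (gen a) + δ) {a b : α}
    (h : FarLink S q (R - K) a b) : slack q (c a) R (s (gen a)) ≤ K + δ := by
  obtain ⟨w, ha, -, hw⟩ := h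
  have := hS a w ha
  have := dist_triangle q (c a) w
  rw [dist_comm (c a) w] at this
  unfold slack
  linarith

/-- The bounds on `f` are lower bounds for the products of each centre with the shared point; the
four-point inequality through that point costs one `δ`. -/
theorem FarLink.le_gromovProduct (hH : IsHyperbolic H δ)
    (hS : ∀ a, ∀ w ∈ S a, dist w (c a) ≤ s (gen a) + δ) {a b : α}
    (h : FarLink S q (R - K) a b) {f : ℝ}
    (hfa : f ≤ R - s (gen a) - (K + slack q (c a) R (s (gen a)) + δ) / 2)
    (hfb : f ≤ R - s (gen b) - (K + slack q (c b) R (s (gen b)) + δ) / 2) :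
    f - δ ≤ gromovProduct (c a) (c b) q := by
  obtain ⟨w, ha, hb, hw⟩ := h
  have h1 := hS a w ha
  have h2 := hS b w hb
  have h3 := hH.min_gromovProduct_le (c a) w (c b) q
  refine le_trans (sub_le_sub_right (le_min ?_ ?_) δ) h3
  · unfold gromovProduct slack at *
    rw [dist_comm (c a) q, dist_comm w q, dist_comm (c a) w]
    linarith
  · unfold gromovProduct slack at *
    rw [dist_comm (c b) q, dist_comm w q]
    linarith

/-- Indices of the same kind that are joined by a chain of far links through indices of smaller
radius are equal. -/
theorem rankedConn_unique (hδ : 0 ≤ δ) (hH : IsHyperbolic H δ)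
    (hS : ∀ a, ∀ w ∈ S a, dist w (c a) ≤ s (gen a) + δ)
    (hsep : ∀ a b, gen a = gen b → a ≠ b → ρ < dist (c a) (c b))
    (hslack : ∀ a, 0 ≤ slack q (c a) R (s (gen a)))
    (hρ : 2 * (K + (m + 2) * δ) ≤ ρ) {e : Fin m → ℕ} (he : Function.Injective e)
    (hem : ∀ i, e i < m) (hes : ∀ i j, e i ≤ e j → s i ≤ s j) {E : α → α → Prop}
    (hE : ∀ a b, E a b → FarLink S q (R - K) a b) (k : ℕ) (a b : α)
    (ha : e (gen a) = k) (hb : e (gen b) = k) (hab : RankedConn E (fun a => e (gen a)) k a b) :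
    a = b := by
  have hgen : gen a = gen b := he (ha.trans hb.symm)
  by_contra hne
  have h1 := hsep a b hgen hne
  have key := RankedConn.le_of_edge (rk := fun a => e (gen a)) (E := E) hδ
    -- Slack at most `K + δ` bounds the half-sum by `K + δ`; the second `δ` is lost at the shared
    -- point.
    (g := fun a b => gromovProduct (c a) (c b) q) (P := R - s (gen a) - K - 2 * δ)
    (fun a b d => hH.min_gromovProduct_le (c a) (c b) (c d) q) {d | e (gen d) ≤ k}
    (fun x y hxy hx hy => by
      have hl := hE x y hxy
      have e1 := hl.slack_le (c := c) (s := s) (gen := gen) hS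
      have e2 := hl.symm.slack_le (c := c) (s := s) (gen := gen) hS
      have f1 := hes (gen x) (gen a) (ha ▸ hx)
      have f2 := hes (gen y) (gen a) (ha ▸ hy)
      have := hl.le_gromovProduct hH hS (f := R - s (gen a) - K - δ) (by linarith) (by linarith)
      linarith) k (fun d hd => le_of_lt hd) (by simp [ha]) (by simp [hb]) hab
  have hk : (k : ℝ) * δ ≤ m * δ := by
    have : k ≤ m := ha ▸ (hem (gen a)).le
    gcongr
  -- Nonnegative slack puts both centres within `R - s (gen a)` of `q`, so the large product forces
  -- their distance to be at most `2 * (K + (m + 2) * δ) ≤ ρ`.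
  have s1 := hslack a
  have s2 := hslack b
  rw [← hgen] at s2
  unfold slack at s1 s2
  simp only [gromovProduct] at key
  rw [dist_comm (c a) q, dist_comm (c b) q] at key
  linarith

/-- A component of the far link relation has a unique index of the largest radius, and
a lower bound for its links gives one for all Gromov products of its centres. -/
theorem component_structure (hδ : 0 ≤ δ) (hH : IsHyperbolic H δ) [Finite α]
    (hS : ∀ a, ∀ w ∈ S a, dist w (c a) ≤ s (gen a) + δ)
    (hsep : ∀ a b, gen a = gen b → a ≠ b → ρ < dist (c a) (c b))
    (hslack : ∀ a, 0 ≤ slack q (c a) R (s (gen a)))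
    (hK : 0 ≤ K) (hρ : 2 * (K + (m + 2) * δ) ≤ ρ) (o : α)
    (ho : slack q (c o) R (s (gen o)) = 0) {A : Set α}
    (hA : A = {a | Relation.ReflTransGen (FarLink S q (R - K)) o a}) :
    (∀ a ∈ A, slack q (c a) R (s (gen a)) ≤ K + δ) ∧
    (∀ f : ℝ, (∀ a ∈ A, f ≤ R - s (gen a) - (K + slack q (c a) R (s (gen a)) + δ) / 2) →
      ∀ a ∈ A, ∀ b ∈ A, f - (m + 1) * δ ≤ gromovProduct (c a) (c b) q) ∧
    ∃ t ∈ A, (∀ a ∈ A, s (gen a) ≤ s (gen t)) ∧ ∀ a ∈ A, gen a = gen t → a = t := by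
  have h1 : ∀ a ∈ A, slack q (c a) R (s (gen a)) ≤ K + δ := by
    intro a ha
    rw [hA] at ha
    rcases Relation.ReflTransGen.cases_tail ha with h | ⟨b, -, hb⟩
    · rw [h, ho]; linarith
    · exact hb.symm.slack_le hS
  obtain ⟨e, he, hem, hes⟩ := exists_rank s
  set E : α → α → Prop := fun a b => FarLink S q (R - K) a b ∧ a ∈ A ∧ b ∈ A with hEdef
  have hconn : ∀ a ∈ A, Relation.ReflTransGen E o a := by
    intro a ha
    rw [hA] at ha
    induction ha with
    | refl => exact .refl
    | tail hx hxy ih =>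
      exact ih.tail ⟨hxy, by rw [hA]; exact hx, by rw [hA]; exact hx.tail hxy⟩
  have hsymm : Std.Symm E := ⟨fun a b h => ⟨h.1.symm, h.2.2, h.2.1⟩⟩
  have hconn' : ∀ a ∈ A, ∀ b ∈ A, Relation.ReflTransGen E a b := fun a ha b hb =>
    (symm (hconn a ha)).trans (hconn b hb)
  have h2 : ∀ f : ℝ, (∀ a ∈ A, f ≤ R - s (gen a) - (K + slack q (c a) R (s (gen a)) + δ) / 2) →
      ∀ a ∈ A, ∀ b ∈ A, f - (m + 1) * δ ≤ gromovProduct (c a) (c b) q := by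
    intro f hf a ha b hb
    rcases RankedConn.of_reflTransGen (rk := fun a => e (gen a)) (m := m)
      (rankedConn_unique hδ hH hS hsep hslack hρ he hem hes (fun a b h => h.1))
      (fun a => hem _) (hconn' a ha b hb) with h | h
    · subst h
      have := hf a ha
      have e1 := h1 a ha
      have e2 : 0 ≤ (m + 1) * δ := by positivity
      simp only [gromovProduct, dist_self]
      unfold slack at this e1
      rw [dist_comm (c a) q]
      linarith
    · have := RankedConn.le_of_edge (rk := fun a => e (gen a)) (E := E) hδ
        (g := fun a b => gromovProduct (c a) (c b) q) (P := f - δ)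
        (fun a b d => hH.min_gromovProduct_le (c a) (c b) (c d) q) Set.univ
        (fun x y hxy _ _ => hxy.1.le_gromovProduct hH hS (hf x hxy.2.1) (hf y hxy.2.2))
        m (fun _ _ => Set.mem_univ _) (Set.mem_univ _) (Set.mem_univ _) h
      linarith
  refine ⟨h1, h2, ?_⟩
  have hoA : o ∈ A := by rw [hA]; exact .refl
  obtain ⟨t, htA, ht⟩ := Set.exists_max_image A (fun a => e (gen a)) A.toFinite ⟨o, hoA⟩
  have hmax : ∀ a ∈ A, s (gen a) ≤ s (gen t) := fun a ha => hes _ _ (ht a ha)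
  refine ⟨t, htA, hmax, fun a ha hat => ?_⟩
  by_contra hne
  have := hsep a t hat hne
  have g1 := h2 (R - s (gen t) - K - δ) (fun b hb => by linarith [h1 b hb, hmax b hb]) a ha t htA
  have s1 := hslack a
  have s2 := hslack t
  rw [hat] at s1
  unfold slack at s1 s2
  unfold gromovProduct at g1
  rw [dist_comm (c a) q, dist_comm (c t) q] at g1
  linarith

/-- Pigeonhole over `m + 1` scales: at some scale `X`, all indices of the component of `o` whose
radius is nearly the largest one have slack at most `X`. -/
theorem exists_good_level (hδ : 0 < δ) (hH : IsHyperbolic H δ) [Finite α]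
    (hS : ∀ a, ∀ w ∈ S a, dist w (c a) ≤ s (gen a) + δ)
    (hsep : ∀ a b, gen a = gen b → a ≠ b → ρ < dist (c a) (c b))
    (hslack : ∀ a, 0 ≤ slack q (c a) R (s (gen a)))
    (hρ : (4 * (m : ℝ) ^ 2 + 26 * m + 22) * δ ≤ ρ) (o : α)
    (ho : slack q (c o) R (s (gen o)) = 0) :
    ∃ X : ℝ, 0 ≤ X ∧ 2 * (X + (2 * m + 9) * δ + (m + 2) * δ) ≤ ρ ∧
      ∀ a t, Relation.ReflTransGen (FarLink S q (R - (X + (2 * m + 9) * δ))) o a →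
        Relation.ReflTransGen (FarLink S q (R - (X + (2 * m + 9) * δ))) o t →
        (∀ b, Relation.ReflTransGen (FarLink S q (R - (X + (2 * m + 9) * δ))) o b →
          s (gen b) ≤ s (gen t)) →
        s (gen t) - (2 * m + 9) * δ / 2 < s (gen a) → slack q (c a) R (s (gen a)) ≤ X := by
  by_contra! hcon
  -- The scales are `X_i = i(2m+10)δ` with `K_i = X_i + (2m+9)δ`, so that `K_i + δ = X_{i+1}`. The
  -- top scale `i = m` gives exactly the constant `4m² + 26m + 22`.
  have hbound : ∀ i : Fin (m + 1), 0 ≤ ((i : ℕ) : ℝ) * (2 * m + 10) * δ ∧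
      2 * (((i : ℕ) : ℝ) * (2 * m + 10) * δ + (2 * m + 9) * δ + (m + 2) * δ) ≤ ρ := by
    intro i
    refine ⟨by positivity, ?_⟩
    have hi : ((i : ℕ) : ℝ) ≤ m := by exact_mod_cast Nat.lt_succ_iff.1 i.2
    have : ((i : ℕ) : ℝ) * ((2 * m + 10) * δ) ≤ m * ((2 * m + 10) * δ) := by gcongr
    linarith
  choose a t ha ht htop hnear hbig using fun i : Fin (m + 1) =>
    hcon _ (hbound i).1 (hbound i).2
  obtain ⟨i, j, hij, hgen⟩ : ∃ i j : Fin (m + 1), i < j ∧ gen (a i) = gen (a j) := by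
    obtain ⟨i, j, hne, h⟩ := Fintype.exists_ne_map_eq_of_card_lt (fun i => gen (a i)) (by simp)
    rcases lt_or_gt_of_ne hne with h' | h'
    · exact ⟨i, j, h', h⟩
    · exact ⟨j, i, h', h.symm⟩
  have hij' : ((i : ℕ) : ℝ) + 1 ≤ ((j : ℕ) : ℝ) := by exact_mod_cast hij
  have hX : (((i : ℕ) : ℝ) + 1) * ((2 * m + 10) * δ) ≤ ((j : ℕ) : ℝ) * ((2 * m + 10) * δ) := by
    gcongr
  have hiX : 0 ≤ ((i : ℕ) : ℝ) * ((2 * m + 10) * δ) := by positivity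
  have hm9 : 0 ≤ (2 * m + 9) * δ := by positivity
  obtain ⟨hi1, -⟩ := component_structure (K := ((i : ℕ) : ℝ) * (2 * m + 10) * δ + (2 * m + 9) * δ)
    hδ.le hH hS hsep hslack (add_nonneg (hbound i).1 hm9) (hbound i).2 o ho rfl
  obtain ⟨hj1, hj2, -⟩ := component_structure
    (K := ((j : ℕ) : ℝ) * (2 * m + 10) * δ + (2 * m + 9) * δ)
    hδ.le hH hS hsep hslack (add_nonneg (hbound j).1 hm9) (hbound j).2 o ho rfl
  have hai := hi1 _ (ha i)
  -- The slack of `a i` is at most `K_i + δ ≤ X_j`, whereas that of `a j` exceeds `X_j`.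
  have hne : a i ≠ a j := by
    intro h
    have := hbig j
    rw [← h] at this
    linarith
  have haij : Relation.ReflTransGen
      (FarLink S q (R - (((j : ℕ) : ℝ) * (2 * m + 10) * δ + (2 * m + 9) * δ))) o (a i) :=
    Relation.ReflTransGen.mono (fun _ _ h => h.mono (by linarith)) _ _ (ha i)
  -- Both indices lie in the component at scale `j`. The loss from comparing with the top radius,
  -- less than `(2m+9)δ` in the distance, is paid for by the slack of `a j`, which exceeds `X_j ≥
  -- (2m+10)δ`; hence the centres are too close.
  have g := hj2 (R - s (gen (t j)) - (((j : ℕ) : ℝ) * (2 * m + 10) * δ + (2 * m + 9) * δ) - δ)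
    (fun b hb => by linarith [htop j b hb, hj1 b hb]) _ haij _ (ha j)
  have hd := hsep _ _ hgen hne
  have b1 := hbig j
  have b2 := hbig i
  have b3 := hnear j
  have b4 := (hbound j).2
  rw [hgen] at b2
  unfold slack at b1 b2
  unfold gromovProduct at g
  rw [dist_comm (c (a i)) q, dist_comm (c (a j)) q] at g
  linarith

/-- The set of indices can be cut so that, for the largest ball of one part, which
is the only one of its kind there, all points common to the two parts lie in a ball of
a definitely smaller radius. -/
theorem exists_cut (hδ : 0 < δ) (hH : IsHyperbolic H δ) [Finite α] [Nonempty α]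
    (hS : ∀ a, ∀ w ∈ S a, dist w (c a) ≤ s (gen a) + δ)
    (hsep : ∀ a b, gen a = gen b → a ≠ b → ρ < dist (c a) (c b))
    (hρ : (4 * (m : ℝ) ^ 2 + 26 * m + 22) * δ ≤ ρ) :
    ∃ A : Set α, ∃ t ∈ A, (∀ a ∈ A, gen a = gen t → a = t) ∧
      ∃ p : H, ∀ a ∈ A, ∀ b ∉ A, ∀ w ∈ S a ∩ S b, dist w p ≤ s (gen t) - δ / 2 := by
  obtain ⟨q⟩ : Nonempty H := ‹Nonempty α›.map c
  -- `o` is an index whose ball reaches farthest from `q`, so its slack is zero for the resulting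
  -- `R`.
  obtain ⟨o, ho⟩ := Finite.exists_max fun a => dist q (c a) + s (gen a)
  obtain ⟨R, hR⟩ : ∃ R, R = dist q (c o) + s (gen o) := ⟨_, rfl⟩
  have hslack : ∀ a, 0 ≤ slack q (c a) R (s (gen a)) := fun a => by
    unfold slack; linarith [ho a]
  have hslack0 : slack q (c o) R (s (gen o)) = 0 := by unfold slack; linarith
  obtain ⟨X, hX0, hXρ, hX⟩ := exists_good_level hδ hH hS hsep hslack hρ o hslack0
  obtain ⟨K, hK⟩ : ∃ K, K = X + (2 * m + 9) * δ := ⟨_, rfl⟩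
  rw [← hK] at hX hXρ
  have hK0 : 0 ≤ K := by rw [hK]; positivity
  obtain ⟨A, hA⟩ : ∃ A, A = {a | Relation.ReflTransGen (FarLink S q (R - K)) o a} := ⟨_, rfl⟩
  obtain ⟨h1, h2, t, htA, htop, huniq⟩ :=
    component_structure hδ.le hH hS hsep hslack hK0 hXρ o hslack0 hA
  have hmem : ∀ {a}, a ∈ A ↔ Relation.ReflTransGen (FarLink S q (R - K)) o a := by
    intro a; rw [hA]; rfl
  have hnear : ∀ a ∈ A, s (gen t) - (2 * m + 9) * δ / 2 < s (gen a) →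
      slack q (c a) R (s (gen a)) ≤ X := fun a ha hlt =>
    hX a t (hmem.1 ha) (hmem.1 htA) (fun b hb => htop b (hmem.2 hb)) hlt
  -- A farther common point would link `b` to the component.
  have hcut : ∀ a ∈ A, ∀ b ∉ A, ∀ w ∈ S a ∩ S b, dist q w ≤ R - K := by
    intro a ha b hb w hw
    by_contra! hlt
    exact hb (hmem.2 ((hmem.1 ha).tail ⟨w, hw.1, hw.2, hlt⟩))
  have hmδ : 0 ≤ m * δ := by positivity
  -- `P` is a common lower bound for the products with `c t`. An index either has slack at most `X`
  -- or has radius smaller by at least `(2m+9)δ/2 = (K - X)/2`; both cases yield `(K + X)/2` in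
  -- place of `K`. Since `R - K - P = s (gen t) - 5δ/2`, this gain beats the accumulated error `(m +
  -- 2) * δ`.
  obtain ⟨P, hP⟩ : ∃ P, P = R - s (gen t) - ((K + X) / 2 + (m + 2) * δ) := ⟨_, rfl⟩
  have hgp : ∀ a ∈ A, P ≤ gromovProduct (c a) (c t) q := by
    intro a ha
    refine le_trans ?_ (h2 (R - s (gen t) - (K + X) / 2 - δ) (fun b hb => ?_) a ha t htA)
    · linarith
    · rcases lt_or_ge (s (gen t) - (2 * m + 9) * δ / 2) (s (gen b)) with h | h
      · linarith [hnear b hb h, htop b hb]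
      · linarith [h1 b hb]
  refine ⟨A, t, htA, huniq, ?_⟩
  rcases lt_or_ge P 0 with hP0 | hP0
  · refine ⟨q, fun a ha b hb w hw => ?_⟩
    have := hcut a ha b hb w hw
    rw [dist_comm]
    linarith
  · obtain ⟨γt, hγt⟩ := hH.exists_geodesic q (c t)
    -- At time `P` the geodesics from `q` to all centres of `A` are `δ`-close to the one to `c t`,
    -- so one point `p` serves for every `a`.
    refine ⟨γt P, fun a ha b hb w hw => ?_⟩
    obtain ⟨γ, hγ⟩ := hH.exists_geodesic q (c a)
    have d1 := hH.thin q (c a) (c t) γ γt hγ hγt P hP0 (hgp a ha)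
    have d2 := hH.dist_geodesic_le hγ hP0 ((hgp a ha).trans (gromovProduct_le_left _ _ _)) w
    have d3 := dist_triangle w (γ P) (γt P)
    -- The reserve `2 * δ` pays for `d1` and for the error term in `d2`.
    have d4 : max (dist w q - P) (dist w (c a) - (dist q (c a) - P)) ≤
        s (gen t) - δ / 2 - 2 * δ := by
      refine max_le ?_ ?_
      · have := hcut a ha b hb w hw
        rw [dist_comm] at this
        linarith
      · have e1 := hS a w hw.1
        have e2 := h1 a ha
        have e3 := htop a ha
        rcases lt_or_ge (s (gen t) - (2 * m + 9) * δ / 2) (s (gen a)) with h | h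
        · have := hnear a ha h
          unfold slack at this e2
          linarith
        · unfold slack at e2
          linarith
    linarith

end Components

/-! ### Transvections preserve span and independence. -/

section Transvections

variable {R E : Type*} [Ring R] [AddCommGroup E] [Module R E] {m : ℕ}

variable (R) in
/-- The family `x'` is obtained from `x` by adding to one member a combination of the others. -/
def Step (x x' : Fin m → E) : Prop :=
  ∃ (j : Fin m) (b : Fin m → R), b j = 0 ∧ x' = Function.update x j (x j + ∑ i, b i • x i)

theorem sum_smul_update {x : Fin m → E} {j : Fin m} (b : Fin m → R) (hb : b j = 0) (y : E) :
    ∑ i, b i • Function.update x j y i = ∑ i, b i • x i := by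
  refine Finset.sum_congr rfl fun i _ => ?_
  by_cases h : i = j
  · subst h; simp [hb]
  · rw [Function.update_of_ne h]

theorem Step.symm {x x' : Fin m → E} (h : Step R x x') : Step R x' x := by
  obtain ⟨j, b, hb, rfl⟩ := h
  refine ⟨j, -b, by simp [hb], ?_⟩
  rw [sum_smul_update _ (by simp [hb])]
  simp

theorem Step.span_le {x x' : Fin m → E} (h : Step R x x') :
    Submodule.span R (Set.range x') ≤ Submodule.span R (Set.range x) := by
  obtain ⟨j, b, hb, rfl⟩ := h
  have hx : ∀ i, x i ∈ Submodule.span R (Set.range x) := fun i =>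
    Submodule.subset_span (Set.mem_range_self i)
  rw [Submodule.span_le]
  rintro _ ⟨i, rfl⟩
  by_cases hi : i = j
  · subst hi
    rw [Function.update_self]
    exact add_mem (hx i) (Submodule.sum_mem _ fun l _ => Submodule.smul_mem _ _ (hx l))
  · rw [Function.update_of_ne hi]
    exact hx i

theorem Step.span_eq {x x' : Fin m → E} (h : Step R x x') :
    Submodule.span R (Set.range x') = Submodule.span R (Set.range x) :=
  le_antisymm h.span_le h.symm.span_le

theorem Step.linearIndependent {x x' : Fin m → E} (h : Step R x x')
    (hx : LinearIndependent R x) : LinearIndependent R x' := by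
  obtain ⟨j, b, hb, rfl⟩ := h
  rw [Fintype.linearIndependent_iff] at hx ⊢
  intro g hg
  have key : ∑ i, (g i + g j * b i) • x i = 0 := by
    rw [← hg]
    have : ∀ i, g i • Function.update x j (x j + ∑ l, b l • x l) i =
        g i • x i + if i = j then g j • ∑ l, b l • x l else 0 := by
      intro i
      by_cases hi : i = j
      · subst hi; simp [smul_add]
      · simp [hi]
    simp only [this, Finset.sum_add_distrib, add_smul, mul_smul, Finset.smul_sum]
    simp
  have h0 := hx _ key
  have hj : g j = 0 := by simpa [hb] using h0 j
  intro i
  simpa [hj] using h0 i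

theorem reflTransGen_step_span_eq {x x' : Fin m → E} (h : Relation.ReflTransGen (Step R) x x') :
    Submodule.span R (Set.range x') = Submodule.span R (Set.range x) := by
  induction h with
  | refl => rfl
  | tail _ h ih => rw [h.span_eq, ih]

theorem reflTransGen_step_linearIndependent {x x' : Fin m → E}
    (h : Relation.ReflTransGen (Step R) x x') (hx : LinearIndependent R x) :
    LinearIndependent R x' := by
  induction h with
  | refl => exact hx
  | tail _ h ih => exact h.linearIndependent ih

end Transvections

/-! ### Supports viewed in an orbit. -/

section OrbitSupport

variable {G k ι H : Type*} [Group G] [Ring k] [MulAction G H]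

/-- The points of the orbit of `p₀` that correspond to the support of `x`. -/
def orbitSupp (p₀ : H) (x : ι →₀ MonoidAlgebra k G) : Set H :=
  {w | ∃ i g, (x i).coeff g ≠ 0 ∧ g • p₀ = w}

theorem finite_orbitSupp (p₀ : H) (x : ι →₀ MonoidAlgebra k G) : (orbitSupp p₀ x).Finite := by
  refine (Set.Finite.biUnion x.support.finite_toSet fun i _ =>
    (x i).coeff.support.finite_toSet.image fun g => g • p₀).subset ?_
  rintro _ ⟨i, g, h, rfl⟩
  have : x i ≠ 0 := fun h0 => h (by simp [h0])
  exact Set.mem_biUnion (Finsupp.mem_support_iff.2 this) ⟨g, Finsupp.mem_support_iff.2 h, rfl⟩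

theorem orbitSupp_nonempty (p₀ : H) {x : ι →₀ MonoidAlgebra k G} (hx : x ≠ 0) :
    (orbitSupp p₀ x).Nonempty := by
  obtain ⟨i, hi⟩ := Finsupp.ne_iff.1 hx
  have : (x i).coeff ≠ 0 := fun h => hi (MonoidAlgebra.coeff_eq_zero.1 h)
  obtain ⟨g, hg⟩ := Finsupp.ne_iff.1 this
  exact ⟨_, i, g, hg, rfl⟩

theorem orbitSupp_neg (p₀ : H) (x : ι →₀ MonoidAlgebra k G) :
    orbitSupp p₀ (-x) = orbitSupp p₀ x := by
  simp [orbitSupp]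

theorem smul_mem_of_mem_orbitSupp_single_smul {p₀ w : H} {x : ι →₀ MonoidAlgebra k G} {g : G}
    {r : k} (h : w ∈ orbitSupp p₀ (MonoidAlgebra.single g r • x)) :
    g⁻¹ • w ∈ orbitSupp p₀ x := by
  obtain ⟨i, l, hl, rfl⟩ := h
  rw [Finsupp.smul_apply, smul_eq_mul, MonoidAlgebra.coeff_single_mul_apply] at hl
  exact ⟨i, g⁻¹ * l, right_ne_zero_of_mul hl, mul_smul _ _ _⟩

theorem exists_mem_of_mem_orbitSupp_sum {p₀ w : H} {T : Type*} {s : Finset T}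
    {f : T → ι →₀ MonoidAlgebra k G} (h : w ∈ orbitSupp p₀ (∑ t ∈ s, f t)) :
    ∃ t ∈ s, w ∈ orbitSupp p₀ (f t) := by
  obtain ⟨i, g, hg, rfl⟩ := h
  rw [Finsupp.finsetSum_apply, MonoidAlgebra.coeff_sum, Finsupp.finsetSum_apply] at hg
  obtain ⟨t, ht, h⟩ := Finset.exists_ne_zero_of_sum_ne_zero hg
  exact ⟨t, ht, i, g, h, rfl⟩

end OrbitSupport

/-! ### The reduction algorithm over a field. -/

section Reduction

variable {G k ι H : Type*} [Group G] [Field k] [MetricSpace H] [MulAction G H]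
  [IsIsometricSMul G H] {δ ρ : ℝ} {m : ℕ}

/-- A nontrivial relation between nonzero vectors allows one to shrink one of them. -/
theorem exists_smaller (hδ : 0 < δ) (hH : IsHyperbolic H δ)
    (hdisp : ∀ g : G, g ≠ 1 → ∀ p : H, ρ < dist (g • p) p)
    (hρ : (4 * (m : ℝ) ^ 2 + 26 * m + 22) * δ ≤ ρ) (p₀ : H)
    (x : Fin m → ι →₀ MonoidAlgebra k G) (hx : ∀ i, x i ≠ 0) (a : Fin m → MonoidAlgebra k G)
    (ha : ∑ i, a i • x i = 0) (ha0 : ∃ i, a i ≠ 0) :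
    ∃ (j : Fin m) (b : Fin m → MonoidAlgebra k G), b j = 0 ∧ (x j + ∑ i, b i • x i = 0 ∨
      Metric.diam (orbitSupp p₀ (x j + ∑ i, b i • x i)) ≤
        Metric.diam (orbitSupp p₀ (x j)) - δ) := by
  classical
  choose z hz using fun i => hH.exists_center (finite_orbitSupp p₀ (x i))
    (orbitSupp_nonempty p₀ (hx i))
  -- The indices are the individual terms of the relation, and `gen` records which `x i` a term
  -- translates.
  let T := Σ i : Fin m, (a i).coeff.support
  let f : T → MonoidAlgebra k G := fun τ => MonoidAlgebra.single τ.2.1 ((a τ.1).coeff τ.2.1)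
  have hT : Nonempty T := by
    obtain ⟨i, hi⟩ := ha0
    have : (a i).coeff ≠ 0 := fun h => hi (MonoidAlgebra.coeff_eq_zero.1 h)
    obtain ⟨g, hg⟩ := Finsupp.ne_iff.1 this
    exact ⟨⟨i, ⟨g, Finsupp.mem_support_iff.2 hg⟩⟩⟩
  have hsum : ∑ τ : T, f τ • x τ.1 = 0 := by
    rw [← ha, Fintype.sum_sigma]
    refine Finset.sum_congr rfl fun i _ => ?_
    change ∑ g, f ⟨i, g⟩ • x i = a i • x i
    rw [← Finset.sum_smul]
    congr 1
    conv_rhs => rw [← MonoidAlgebra.sum_coeff_single (a i)]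
    exact Finset.sum_coe_sort (a i).coeff.support
      fun g => MonoidAlgebra.single g ((a i).coeff g)
  obtain ⟨A, t, htA, huniq, p, hp⟩ := exists_cut (α := T) (gen := fun τ => τ.1)
    (c := fun τ => τ.2.1 • z τ.1) (s := fun i => Metric.diam (orbitSupp p₀ (x i)) / 2)
    (S := fun τ => {w | τ.2.1⁻¹ • w ∈ orbitSupp p₀ (x τ.1)}) (ρ := ρ) hδ hH
    (fun τ w hw => by
      have := hz _ _ hw
      rwa [← dist_smul τ.2.1, smul_inv_smul] at this)
    (fun τ τ' h hne => by
      obtain ⟨i, g⟩ := τ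
      obtain ⟨i', g'⟩ := τ'
      obtain rfl : i = i' := h
      have hgg : g.1 ≠ g'.1 := fun h => hne (by rw [Subtype.ext h])
      have := hdisp (g'.1⁻¹ * g.1) (fun h => hgg (inv_mul_eq_one.1 h).symm) (z i)
      rwa [← dist_smul g'.1, smul_smul, mul_inv_cancel_left] at this) hρ
  have ht0 : (a t.1).coeff t.2.1 ≠ 0 := Finsupp.mem_support_iff.1 t.2.2
  set y := ∑ τ with τ ∈ A, f τ • x τ.1 with hy
  have hy' : y = -∑ τ with τ ∉ A, f τ • x τ.1 := by
    rw [eq_neg_iff_add_eq_zero, ← hsum]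
    exact Finset.sum_filter_add_sum_filter_not _ _ _
  -- The two expressions for `y` place each support point in a term of `A` and in a term outside
  -- `A`.
  have hysupp : ∀ w ∈ orbitSupp p₀ y,
      dist w p ≤ Metric.diam (orbitSupp p₀ (x t.1)) / 2 - δ / 2 := by
    intro w hw
    obtain ⟨τ, hτ, h1⟩ := exists_mem_of_mem_orbitSupp_sum hw
    rw [hy', orbitSupp_neg] at hw
    obtain ⟨τ', hτ', h2⟩ := exists_mem_of_mem_orbitSupp_sum hw
    exact hp τ (Finset.mem_filter.1 hτ).2 τ' (Finset.mem_filter.1 hτ').2 w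
      ⟨smul_mem_of_mem_orbitSupp_single_smul h1, smul_mem_of_mem_orbitSupp_single_smul h2⟩
  set u : MonoidAlgebra k G := MonoidAlgebra.single t.2.1⁻¹ ((a t.1).coeff t.2.1)⁻¹ with hu
  have huf : u * f t = 1 := by
    simp only [hu, f, MonoidAlgebra.single_mul_single, inv_mul_cancel, inv_mul_cancel₀ ht0]
    rfl
  set F := (Finset.univ.filter (· ∈ A)).erase t with hF
  have hyu : u • y = x t.1 + ∑ i, (u * ∑ τ ∈ F with τ.1 = i, f τ) • x i := by
    have h1 : ∑ i, (∑ τ ∈ F with τ.1 = i, f τ) • x i = ∑ τ ∈ F, f τ • x τ.1 := by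
      rw [← Finset.sum_fiberwise F (fun τ => τ.1)]
      refine Finset.sum_congr rfl fun i _ => ?_
      rw [Finset.sum_smul]
      refine Finset.sum_congr rfl fun τ hτ => ?_
      rw [(Finset.mem_filter.1 hτ).2]
    simp only [mul_smul]
    rw [← Finset.smul_sum, h1, hy, ← Finset.add_sum_erase _ _ (a := t) (by simpa using htA),
      smul_add, ← mul_smul, huf, one_smul]
  refine ⟨t.1, fun i => u * ∑ τ ∈ F with τ.1 = i, f τ, ?_, ?_⟩
  -- `t` is the only term of its kind in `A`, so no further multiple of `x t.1` occurs and the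
  -- change is a transvection.
  · have : (F.filter fun τ => τ.1 = t.1) = ∅ := by
      refine Finset.filter_eq_empty_iff.2 fun τ hτ h => ?_
      rw [hF, Finset.mem_erase, Finset.mem_filter] at hτ
      exact hτ.1 (huniq τ hτ.2.2 h)
    simp only [this, Finset.sum_empty, mul_zero]
  · simp only [← hyu]
    rw [or_iff_not_imp_left]
    intro hne
    have hle : ∀ w ∈ orbitSupp p₀ (u • y), ∀ w' ∈ orbitSupp p₀ (u • y),
        dist w w' ≤ Metric.diam (orbitSupp p₀ (x t.1)) - δ := by
      intro w hw w' hw'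
      have e1 := hysupp _ (smul_mem_of_mem_orbitSupp_single_smul hw)
      have e2 := hysupp _ (smul_mem_of_mem_orbitSupp_single_smul hw')
      rw [← dist_smul t.2.1⁻¹⁻¹]
      exact (dist_triangle_right _ _ p).trans (by linarith)
    obtain ⟨w, hw⟩ := orbitSupp_nonempty p₀ hne
    exact Metric.diam_le_of_forall_dist_le (dist_nonneg.trans (hle w hw w hw)) hle

/-- A linearly dependent family over a group algebra can be transformed by transvections into
one with a zero member. -/
theorem exists_reflTransGen_step_eq_zero (hδ : 0 < δ) (hH : IsHyperbolic H δ) [Nonempty H]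
    (hdisp : ∀ g : G, g ≠ 1 → ∀ p : H, ρ < dist (g • p) p)
    (hρ : (4 * (m : ℝ) ^ 2 + 26 * m + 22) * δ ≤ ρ)
    (x : Fin m → ι →₀ MonoidAlgebra k G) (hx : ¬LinearIndependent (MonoidAlgebra k G) x) :
    ∃ x', Relation.ReflTransGen (Step (MonoidAlgebra k G)) x x' ∧ ∃ i, x' i = 0 := by
  obtain ⟨p₀⟩ := ‹Nonempty H›
  -- Each step lowers the sum of the diameters by at least `δ > 0`, so `N` bounds the number of
  -- steps.
  have key : ∀ (N : ℕ) (x : Fin m → ι →₀ MonoidAlgebra k G),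
      ¬LinearIndependent (MonoidAlgebra k G) x →
      ∑ i, Metric.diam (orbitSupp p₀ (x i)) < N * δ →
      ∃ x', Relation.ReflTransGen (Step (MonoidAlgebra k G)) x x' ∧ ∃ i, x' i = 0 := by
    intro N
    induction N with
    | zero =>
      intro x _ h
      have : 0 ≤ ∑ i, Metric.diam (orbitSupp p₀ (x i)) :=
        Finset.sum_nonneg fun i _ => Metric.diam_nonneg
      simp only [Nat.cast_zero, zero_mul] at h
      linarith
    | succ N ih =>
      intro x hx hN
      by_cases h0 : ∃ i, x i = 0
      · exact ⟨x, .refl, h0⟩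
      push Not at h0
      obtain ⟨a, ha, ha0⟩ := Fintype.not_linearIndependent_iff.1 hx
      obtain ⟨j, b, hb, h⟩ := exists_smaller hδ hH hdisp hρ p₀ x h0 a ha ha0
      have hstep : Step (MonoidAlgebra k G) x (Function.update x j (x j + ∑ i, b i • x i)) :=
        ⟨j, b, hb, rfl⟩
      rcases h with h | h
      · exact ⟨_, .single hstep, j, by rw [Function.update_self, h]⟩
      · obtain ⟨x', hx', h'⟩ := ih _ (fun h => hx (hstep.symm.linearIndependent h)) (by
          have e : (fun i => Metric.diam (orbitSupp p₀
              (Function.update x j (x j + ∑ i, b i • x i) i))) =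
              Function.update (fun i => Metric.diam (orbitSupp p₀ (x i))) j
                (Metric.diam (orbitSupp p₀ (x j + ∑ i, b i • x i))) :=
            funext fun i => Function.apply_update (fun _ v => Metric.diam (orbitSupp p₀ v)) x j _ i
          rw [e, Finset.sum_update_of_mem (Finset.mem_univ j)]
          rw [← Finset.sum_erase_add _ _ (Finset.mem_univ j), Finset.erase_eq] at hN
          push_cast at hN
          linarith)
        exact ⟨x', .head hstep hx', h'⟩
  obtain ⟨N, hN⟩ := exists_nat_gt ((∑ i, Metric.diam (orbitSupp p₀ (x i))) / δ)
  exact key N x hx (by rwa [div_lt_iff₀ hδ] at hN)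

/-- Over a group algebra, a finite family in a free module can be replaced by a linearly
independent one with the same span. -/
theorem exists_linearIndependent_span_eq (hδ : 0 < δ) (hH : IsHyperbolic H δ) [Nonempty H]
    (hdisp : ∀ g : G, g ≠ 1 → ∀ p : H, ρ < dist (g • p) p) :
    ∀ (m : ℕ), (4 * (m : ℝ) ^ 2 + 26 * m + 22) * δ ≤ ρ → ∀ x : Fin m → ι →₀ MonoidAlgebra k G,
      ∃ r ≤ m, ∃ y : Fin r → ι →₀ MonoidAlgebra k G, LinearIndependent (MonoidAlgebra k G) y ∧
        Submodule.span (MonoidAlgebra k G) (Set.range y) =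
          Submodule.span (MonoidAlgebra k G) (Set.range x) := by
  intro m
  induction m with
  | zero => exact fun _ x => ⟨0, le_rfl, x, linearIndependent_empty_type, rfl⟩
  | succ m ih =>
    intro hρ x
    by_cases hx : LinearIndependent (MonoidAlgebra k G) x
    · exact ⟨m + 1, le_rfl, x, hx, rfl⟩
    obtain ⟨x', hxx', i, hi⟩ := exists_reflTransGen_step_eq_zero hδ hH hdisp hρ x hx
    obtain ⟨r, hr, y, hy, hspan⟩ := ih (by
      refine le_trans ?_ hρ
      gcongr <;> simp) (fun l => x' (i.succAbove l))
    refine ⟨r, hr.trans m.le_succ, y, hy, ?_⟩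
    rw [hspan, ← reflTransGen_step_span_eq hxx']
    refine le_antisymm (Submodule.span_mono ?_) (Submodule.span_le.2 ?_)
    · rintro _ ⟨l, rfl⟩
      exact ⟨_, rfl⟩
    · rintro _ ⟨l, rfl⟩
      rcases Fin.eq_self_or_eq_succAbove i l with rfl | ⟨l, rfl⟩
      · rw [hi]; exact zero_mem _
      · exact Submodule.subset_span ⟨l, rfl⟩

end Reduction

/-! ### Passing from `ℤ[G]` to `ℚ[G]` and to `𝔽_p[G]`. -/

section Reduce

variable {G ι : Type*} [Group G]

variable (G) in
/-- The change of coefficients `ℤ[G] → k[G]`. -/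
noncomputable def coeffHom (k : Type*) [Ring k] : MonoidAlgebra ℤ G →+* MonoidAlgebra k G :=
  MonoidAlgebra.mapRingHom G (Int.castRingHom k)

theorem coeff_coeffHom (k : Type*) [Ring k] (a : MonoidAlgebra ℤ G) (g : G) :
    (coeffHom G k a).coeff g = (a.coeff g : k) :=
  MonoidAlgebra.coeff_mapRingHom _ _ _

variable (ι G) in
/-- The change of coefficients from `ℤ` to `k` in a free module. -/
noncomputable def reduce (k : Type*) [Ring k] :
    (ι →₀ MonoidAlgebra ℤ G) →ₛₗ[coeffHom G k] (ι →₀ MonoidAlgebra k G) :=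
  Finsupp.mapRange.linearMap (coeffHom G k).toSemilinearMap

theorem coeffHom_injective (k : Type*) [Ring k] [CharZero k] :
    Function.Injective (coeffHom G k) := by
  intro a b h
  ext g
  have := congrArg (fun z => z.coeff g) h
  simpa [coeff_coeffHom] using this

theorem reduce_injective (k : Type*) [Ring k] [CharZero k] :
    Function.Injective (reduce G ι k) := by
  intro x y h
  ext1 i
  exact coeffHom_injective k (DFunLike.congr_fun h i)

theorem coeffHom_zmod_surjective (p : ℕ) : Function.Surjective (coeffHom G (ZMod p)) :=
  MonoidAlgebra.map_surjective (Int.castRingHom (ZMod p)).toAddMonoidHom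
    ZMod.intCast_surjective

theorem exists_eq_smul_of_coeffHom_eq_zero {p : ℕ} {a : MonoidAlgebra ℤ G}
    (h : coeffHom G (ZMod p) a = 0) : ∃ b, a = p • b := by
  refine ⟨.ofCoeff (a.coeff.mapRange (· / (p : ℤ)) (by simp)), ?_⟩
  ext g
  have hg : ((a.coeff g : ℤ) : ZMod p) = 0 := by rw [← coeff_coeffHom, h]; rfl
  have := (ZMod.intCast_zmod_eq_zero_iff_dvd _ _).1 hg
  rw [MonoidAlgebra.coeff_smul, Finsupp.smul_apply, Finsupp.mapRange_apply, nsmul_eq_mul]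
  exact (Int.mul_ediv_cancel' this).symm

theorem exists_eq_smul_of_reduce_eq_zero {p : ℕ} {x : ι →₀ MonoidAlgebra ℤ G}
    (h : reduce G ι (ZMod p) x = 0) : ∃ y, x = p • y := by
  classical
  choose b hb using fun i => exists_eq_smul_of_coeffHom_eq_zero (DFunLike.congr_fun h i)
  refine ⟨Finsupp.onFinset x.support (fun i => if x i = 0 then 0 else b i) ?_, ?_⟩
  · intro i hi
    simp only [ne_eq, ite_eq_left_iff, Classical.not_imp] at hi
    simpa using hi.1
  · ext1 i
    rw [Finsupp.smul_apply, Finsupp.onFinset_apply]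
    split_ifs with h0
    · rw [h0, smul_zero]
    · exact hb i

theorem exists_coeffHom_eq_smul (b : MonoidAlgebra ℚ G) :
    ∃ N : ℕ, N ≠ 0 ∧ ∃ a, coeffHom G ℚ a = N • b := by
  refine ⟨∏ g ∈ b.coeff.support, (b.coeff g).den,
    Finset.prod_ne_zero_iff.2 fun g _ => (b.coeff g).den_nz, ?_⟩
  set N := ∏ g ∈ b.coeff.support, (b.coeff g).den
  refine ⟨.ofCoeff (b.coeff.mapRange (fun q => ((N : ℚ) * q).num) (by simp)), ?_⟩
  ext g
  rw [coeff_coeffHom, MonoidAlgebra.coeff_smul, Finsupp.smul_apply, Finsupp.mapRange_apply,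
    nsmul_eq_mul]
  by_cases hg : g ∈ b.coeff.support
  · obtain ⟨c, hc⟩ : (b.coeff g).den ∣ N := Finset.dvd_prod_of_mem _ hg
    have : (N : ℚ) * b.coeff g = ((c * (b.coeff g).num : ℤ) : ℚ) := by
      rw [hc]
      push_cast
      rw [mul_comm ((b.coeff g).den : ℚ), mul_assoc, Rat.den_mul_eq_num]
    rw [this, Rat.num_intCast]
  · rw [Finsupp.notMem_support_iff.1 hg]; simp

theorem exists_reduce_eq_smul {T : Type*} (x : T → ι →₀ MonoidAlgebra ℤ G)
    {v : ι →₀ MonoidAlgebra ℚ G}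
    (hv : v ∈ Submodule.span (MonoidAlgebra ℚ G) (Set.range fun t => reduce G ι ℚ (x t))) :
    ∃ N : ℕ, N ≠ 0 ∧ ∃ u ∈ Submodule.span (MonoidAlgebra ℤ G) (Set.range x),
      reduce G ι ℚ u = N • v := by
  induction hv using Submodule.span_induction with
  | mem v h =>
    obtain ⟨t, rfl⟩ := h
    exact ⟨1, one_ne_zero, x t, Submodule.subset_span ⟨t, rfl⟩, (one_smul _ _).symm⟩
  | zero => exact ⟨1, one_ne_zero, 0, zero_mem _, by simp⟩
  | add v w _ _ hv hw =>
    obtain ⟨N, hN, u, hu, h⟩ := hv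
    obtain ⟨N', hN', u', hu', h'⟩ := hw
    refine ⟨N * N', mul_ne_zero hN hN', N' • u + N • u',
      add_mem (nsmul_mem hu _) (nsmul_mem hu' _), ?_⟩
    rw [map_add, map_nsmul, map_nsmul, h, h', smul_add, smul_smul, smul_smul, mul_comm N']
  | smul a v _ hv =>
    obtain ⟨N, hN, u, hu, h⟩ := hv
    obtain ⟨N', hN', a', ha'⟩ := exists_coeffHom_eq_smul a
    refine ⟨N' * N, mul_ne_zero hN' hN, a' • u, Submodule.smul_mem _ _ hu, ?_⟩
    rw [map_smulₛₗ, ha', h, smul_assoc, smul_comm a N, smul_smul]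

end Reduce

/-! ### Lifting transvections, dividing by primes, and determinants. -/

section Lattice

variable {R S N E : Type*} [Ring R] [Ring S] [AddCommGroup N] [Module R N] [AddCommGroup E]
  [Module S E] {φ : R →+* S} {r : ℕ}

theorem Step.exists_lift (hφ : Function.Surjective φ) (ψ : N →ₛₗ[φ] E) {x : Fin r → N}
    {X : Fin r → E} (h : Step S (fun i => ψ (x i)) X) :
    ∃ x', Step R x x' ∧ X = fun i => ψ (x' i) := by
  obtain ⟨j, b, hb, rfl⟩ := h
  choose a ha using fun i => hφ (b i)
  -- The chosen lift of `b j = 0` need not vanish, so it is reset to `0` to keep a transvection.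
  have ha' : ∀ i, φ (Function.update a j 0 i) = b i := by
    intro i
    by_cases h : i = j
    · subst h; simp [hb]
    · rw [Function.update_of_ne h, ha]
  refine ⟨_, ⟨j, Function.update a j 0, Function.update_self .., rfl⟩, ?_⟩
  ext1 i
  by_cases h : i = j
  · subst h
    simp only [Function.update_self, map_add, map_sum, map_smulₛₗ, ha']
  · simp only [Function.update_of_ne h]

theorem exists_lift_reflTransGen_step (hφ : Function.Surjective φ) (ψ : N →ₛₗ[φ] E)
    {x : Fin r → N} {X : Fin r → E}
    (h : Relation.ReflTransGen (Step S) (fun i => ψ (x i)) X) :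
    ∃ x', Relation.ReflTransGen (Step R) x x' ∧ X = fun i => ψ (x' i) := by
  induction h with
  | refl => exact ⟨x, .refl, rfl⟩
  | tail _ h ih =>
    obtain ⟨x', hx', rfl⟩ := ih
    obtain ⟨x'', hx'', rfl⟩ := h.exists_lift hφ ψ
    exact ⟨x'', hx'.tail hx'', rfl⟩

/-- Through the semilinear `Λ`, a transvection over the possibly noncommutative `R` becomes an
integer row operation. -/
theorem Step.det_eq {ε : R →+* ℤ} (Λ : N →ₛₗ[ε] (Fin r → ℤ)) {x x' : Fin r → N}
    (h : Step R x x') :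
    (Matrix.of fun i => Λ (x' i)).det = (Matrix.of fun i => Λ (x i)).det := by
  obtain ⟨j, b, hb, rfl⟩ := h
  have : (Matrix.of fun i => Λ (Function.update x j (x j + ∑ i, b i • x i) i)) =
      (Matrix.of fun i => Λ (x i)).updateRow j ((Matrix.of fun i => Λ (x i)) j +
        ∑ i, ε (b i) • (Matrix.of fun i => Λ (x i)) i) := by
    ext i l
    by_cases h : i = j
    · subst h
      simp
    · simp [h]
  rw [this, Matrix.det_updateRow_add, Matrix.updateRow_eq_self, Matrix.det_updateRow_sum, hb,
    map_zero, zero_smul, add_zero]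

theorem reflTransGen_step_det_eq {ε : R →+* ℤ} (Λ : N →ₛₗ[ε] (Fin r → ℤ)) {x x' : Fin r → N}
    (h : Relation.ReflTransGen (Step R) x x') :
    (Matrix.of fun i => Λ (x' i)).det = (Matrix.of fun i => Λ (x i)).det := by
  induction h with
  | refl => rfl
  | tail _ h ih => rw [h.det_eq, ih]

theorem exists_prime_smul_mem (P : Submodule R N) {v : N} (hv : v ∉ P) {M : ℕ} (hM : M ≠ 0)
    (h : M • v ∈ P) : ∃ p : ℕ, p.Prime ∧ ∃ w ∉ P, p • w ∈ P := by
  by_contra! hcon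
  have key : ∀ M : ℕ, M ≠ 0 → ∀ v, M • v ∈ P → v ∈ P := by
    intro M
    induction M using induction_on_primes with
    | zero => exact fun h => absurd rfl h
    | one => intro _ v h; simpa using h
    | prime_mul p a hp ih =>
      intro hpa v h
      rw [mul_smul] at h
      by_contra hv
      exact hcon p hp (a • v) (fun h' => hv (ih (right_ne_zero_of_mul hpa) v h')) h
  exact hv (key M hM v h)

/-- Dividing a member of a linearly independent family by a natural number. -/
theorem linearIndependent_update_of_smul [IsAddTorsionFree R] {p : ℕ} (hp : p ≠ 0)
    {x : Fin r → N} (hx : LinearIndependent R x) {j : Fin r} {y : N} (hy : x j = p • y) :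
    LinearIndependent R (Function.update x j y) := by
  rw [Fintype.linearIndependent_iff] at hx ⊢
  intro c hc
  have key := hx (fun i => if i = j then c i else p • c i) (by
    rw [← smul_zero p, ← hc, Finset.smul_sum]
    refine Finset.sum_congr rfl fun i _ => ?_
    by_cases h : i = j
    · subst h
      rw [if_pos rfl, Function.update_self, hy, smul_comm]
    · rw [if_neg h, Function.update_of_ne h, smul_assoc])
  intro i
  have := key i
  by_cases h : i = j
  · simpa [h] using this
  · rw [if_neg h] at this
    exact (smul_eq_zero_iff_right hp).1 this

theorem span_le_span_update {p : ℕ} {x : Fin r → N} {j : Fin r} {y : N} (hy : x j = p • y) :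
    Submodule.span R (Set.range x) ≤ Submodule.span R (Set.range (Function.update x j y)) := by
  rw [Submodule.span_le]
  rintro _ ⟨i, rfl⟩
  by_cases h : i = j
  · subst h
    rw [hy]
    refine nsmul_mem ?_ p
    exact Submodule.subset_span ⟨i, Function.update_self i y x⟩
  · exact Submodule.subset_span ⟨i, Function.update_of_ne h y x⟩

theorem det_update_smul {ε : R →+* ℤ} (Λ : N →ₛₗ[ε] (Fin r → ℤ)) {p : ℕ} {x : Fin r → N}
    {j : Fin r} {y : N} (hy : x j = p • y) :
    (Matrix.of fun i => Λ (x i)).det = p * (Matrix.of fun i => Λ (Function.update x j y i)).det := by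
  have : (Matrix.of fun i => Λ (x i)) =
      (Matrix.of fun i => Λ (Function.update x j y i)).updateRow j
        ((p : ℤ) • (Matrix.of fun i => Λ (Function.update x j y i)) j) := by
    ext i l
    by_cases h : i = j
    · subst h
      simp [hy]
    · simp [h]
  rw [this, Matrix.det_updateRow_smul, Matrix.updateRow_eq_self]

end Lattice

instance isAddTorsionFree_monoidAlgebra_int (G : Type*) [Group G] :
    IsAddTorsionFree (MonoidAlgebra ℤ G) :=
  Function.Injective.isAddTorsionFree (MonoidAlgebra.coeffAddEquiv (R := ℤ) (M := G)).toAddMonoidHom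
    MonoidAlgebra.coeff_injective

/-! ### Descent on the determinant. -/

section Descent

variable {R N : Type*} [Ring R] [AddCommGroup N] [Module R N] {ε : R →+* ℤ} {r : ℕ}

variable (ε) in
/-- Integral coordinates, up to a factor `K`, with respect to a linearly independent family whose
span contains all multiples by `K`. -/
theorem exists_semilinear_coordinates {y : Fin r → N} (hy : LinearIndependent R y) {K : ℕ}
    (hK : ∀ v : N, K • v ∈ Submodule.span R (Set.range y)) :
    ∃ Λ : N →ₛₗ[ε] (Fin r → ℤ), ∀ i, Λ (y i) = (K : ℤ) • Pi.single i 1 := by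
  -- Multiplication by `K` sends all of `N` into the span, where coordinates exist; `ε` then makes
  -- them integers.
  let f : N →ₗ[R] Submodule.span R (Set.range y) :=
    LinearMap.codRestrict _ (K • LinearMap.id) hK
  have hf : ∀ i, hy.repr (f (y i)) = K • Finsupp.single i 1 := by
    intro i
    rw [← hy.repr_eq_single i ⟨y i, Submodule.subset_span ⟨i, rfl⟩⟩ rfl, ← map_nsmul]
    rfl
  refine ⟨⟨⟨fun v l => ε (hy.repr (f v) l), fun v w => ?_⟩, fun a v => ?_⟩, fun i => ?_⟩
  · ext l; simp
  · ext l; simp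
  · ext l
    change ε (hy.repr (f (y i)) l) = _
    rw [hf]
    by_cases h : l = i
    · subst h; simp
    · simp [h]

/-- Suppose that, whenever the span of a linearly independent family is not closed under division
by a prime `p`, transvections make one of its members divisible by `p`. Then a linearly independent
family whose span has bounded exponent in the module can be replaced by one that spans it. -/
theorem exists_linearIndependent_span_eq_top [IsAddTorsionFree R] (Λ : N →ₛₗ[ε] (Fin r → ℤ))
    (hdiv : ∀ y : Fin r → N, LinearIndependent R y → ∀ p : ℕ, p.Prime →
      ∀ w ∉ Submodule.span R (Set.range y), p • w ∈ Submodule.span R (Set.range y) →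
      ∃ x, Relation.ReflTransGen (Step R) y x ∧ ∃ j z, x j = p • z) :
    ∀ (d : ℕ) (y : Fin r → N), LinearIndependent R y →
      (∃ K : ℕ, K ≠ 0 ∧ ∀ v : N, K • v ∈ Submodule.span R (Set.range y)) →
      (Matrix.of fun i => Λ (y i)).det ≠ 0 → (Matrix.of fun i => Λ (y i)).det.natAbs ≤ d →
      ∃ y' : Fin r → N, LinearIndependent R y' ∧ Submodule.span R (Set.range y') = ⊤ := by
  intro d
  induction d with
  | zero =>
    intro y _ _ h0 h1
    exact absurd (Int.natAbs_eq_zero.1 (Nat.le_zero.1 h1)) h0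
  | succ d ih =>
    intro y hy ⟨K, hK0, hK⟩ hdet0 hdet
    by_cases htop : Submodule.span R (Set.range y) = ⊤
    · exact ⟨y, hy, htop⟩
    obtain ⟨v, hv⟩ : ∃ v, v ∉ Submodule.span R (Set.range y) := by
      by_contra! h
      exact htop (Submodule.eq_top_iff'.2 h)
    obtain ⟨p, hp, w, hw, hpw⟩ := exists_prime_smul_mem _ hv hK0 (hK v)
    obtain ⟨x, hx, j, z, hxz⟩ := hdiv y hy p hp w hw hpw
    have hdet' := det_update_smul Λ hxz
    rw [reflTransGen_step_det_eq Λ hx] at hdet'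
    refine ih (Function.update x j z)
      (linearIndependent_update_of_smul hp.ne_zero
        (reflTransGen_step_linearIndependent hx hy) hxz)
      ⟨K, hK0, fun v => span_le_span_update hxz ?_⟩ ?_ ?_
    · rw [reflTransGen_step_span_eq hx]
      exact hK v
    · intro h
      rw [h, mul_zero] at hdet'
      exact hdet0 hdet'
    · rw [hdet', Int.natAbs_mul, Int.natAbs_natCast] at hdet
      rw [hdet'] at hdet0
      have h1 := Int.natAbs_pos.2 (right_ne_zero_of_mul hdet0)
      -- The old determinant is `p ≥ 2` times the new one, which is nonzero.
      have := Nat.mul_le_mul_right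
        ((Matrix.of fun i => Λ (Function.update x j z i)).det.natAbs) hp.two_le
      omega

theorem free_of_exists_division [IsAddTorsionFree R] (ε : R →+* ℤ) {y : Fin r → N}
    (hy : LinearIndependent R y) {K : ℕ} (hK0 : K ≠ 0)
    (hK : ∀ v : N, K • v ∈ Submodule.span R (Set.range y))
    (hdiv : ∀ y : Fin r → N, LinearIndependent R y → ∀ p : ℕ, p.Prime →
      ∀ w ∉ Submodule.span R (Set.range y), p • w ∈ Submodule.span R (Set.range y) →
      ∃ x, Relation.ReflTransGen (Step R) y x ∧ ∃ j z, x j = p • z) :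
    Module.Free R N := by
  obtain ⟨Λ, hΛ⟩ := exists_semilinear_coordinates ε hy hK
  have hdet : (Matrix.of fun i => Λ (y i)).det ≠ 0 := by
    have : (Matrix.of fun i => Λ (y i)) = (K : ℤ) • (1 : Matrix (Fin r) (Fin r) ℤ) := by
      ext i l
      simp [hΛ, Matrix.one_apply, Pi.single_apply, eq_comm]
    rw [this, Matrix.det_smul, Matrix.det_one, mul_one]
    exact pow_ne_zero _ (by exact_mod_cast hK0)
  obtain ⟨y', hy', hspan⟩ :=
    exists_linearIndependent_span_eq_top Λ hdiv _ y hy ⟨K, hK0, hK⟩ hdet le_rfl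
  exact Module.Free.of_basis (Module.Basis.mk hy' hspan.ge)

end Descent

/-! ### The integral case: pure submodules. -/

section Integral

variable {G ι H N : Type*} [Group G] [MetricSpace H] [MulAction G H]
  [IsIsometricSMul G H] {δ ρ : ℝ} {n r : ℕ} [AddCommGroup N] [Module (MonoidAlgebra ℤ G) N]

/-- A finitely generated submodule of a free module has a linearly independent family whose span
has bounded exponent in it. -/
theorem exists_linearIndependent_smul_mem_span (hδ : 0 < δ) (hH : IsHyperbolic H δ) [Nonempty H]
    (hdisp : ∀ g : G, g ≠ 1 → ∀ p : H, ρ < dist (g • p) p)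
    (hρ : (4 * (n : ℝ) ^ 2 + 26 * n + 22) * δ ≤ ρ)
    (φ : N →ₗ[MonoidAlgebra ℤ G] (ι →₀ MonoidAlgebra ℤ G)) (hφ : Function.Injective φ)
    {x : Fin n → N} (hx : Submodule.span (MonoidAlgebra ℤ G) (Set.range x) = ⊤) :
    ∃ r ≤ n, ∃ y : Fin r → N, LinearIndependent (MonoidAlgebra ℤ G) y ∧ ∃ K : ℕ, K ≠ 0 ∧
      ∀ v : N, K • v ∈ Submodule.span (MonoidAlgebra ℤ G) (Set.range y) := by
  have hinj : Function.Injective fun v => reduce G ι ℚ (φ v) := (reduce_injective ℚ).comp hφ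
  have hlift : ∀ {T : Type} (x : T → N) {v}, v ∈ Submodule.span (MonoidAlgebra ℚ G)
      (Set.range fun t => reduce G ι ℚ (φ (x t))) → ∃ K : ℕ, K ≠ 0 ∧
      ∃ u ∈ Submodule.span (MonoidAlgebra ℤ G) (Set.range x), reduce G ι ℚ (φ u) = K • v := by
    intro T x v hv
    obtain ⟨K, hK, u, hu, h⟩ := exists_reduce_eq_smul (fun t => φ (x t)) hv
    have : Set.range (fun t => φ (x t)) = φ '' Set.range x := Set.range_comp φ x
    rw [this, ← Submodule.map_span] at hu
    obtain ⟨u', hu', rfl⟩ := hu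
    exact ⟨K, hK, u', hu', h⟩
  obtain ⟨r, hr, Y, hY, hspan⟩ := exists_linearIndependent_span_eq hδ hH hdisp n hρ
    (fun i => reduce G ι ℚ (φ (x i)))
  have hYmem : ∀ l, Y l ∈ Submodule.span (MonoidAlgebra ℚ G)
      (Set.range fun i => reduce G ι ℚ (φ (x i))) := fun l =>
    hspan ▸ Submodule.subset_span (Set.mem_range_self l)
  choose K hK u hu hKu using fun l => hlift x (hYmem l)
  have hind : LinearIndependent (MonoidAlgebra ℤ G) u := by
    rw [Fintype.linearIndependent_iff] at hY ⊢
    intro c hc i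
    have key := hY (fun l => K l • coeffHom G ℚ (c l)) (by
      rw [← map_zero (reduce G ι ℚ), ← map_zero φ, ← hc, map_sum, map_sum]
      refine Finset.sum_congr rfl fun l _ => ?_
      rw [map_smul, map_smulₛₗ, hKu, smul_assoc, smul_comm]) i
    rw [← map_nsmul, ← map_zero (coeffHom G ℚ)] at key
    exact (smul_eq_zero_iff_right (hK i)).1 (coeffHom_injective ℚ key)
  have hmem : ∀ i, reduce G ι ℚ (φ (x i)) ∈ Submodule.span (MonoidAlgebra ℚ G)
      (Set.range fun l => reduce G ι ℚ (φ (u l))) := by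
    intro i
    have hle : Submodule.span (MonoidAlgebra ℚ G) (Set.range Y) ≤
        Submodule.span (MonoidAlgebra ℚ G) (Set.range fun l => reduce G ι ℚ (φ (u l))) := by
      refine Submodule.span_le.2 ?_
      rintro _ ⟨l, rfl⟩
      -- Over `ℚ` the factor `K l` is invertible, so the integral vectors `u l` span as much as the
      -- `Y l`.
      have : Y l = MonoidAlgebra.single (1 : G) ((K l : ℚ)⁻¹) • reduce G ι ℚ (φ (u l)) := by
        have hKl : (K l : ℚ) ≠ 0 := by exact_mod_cast hK l
        rw [hKu, ← smul_comm, ← smul_assoc, MonoidAlgebra.smul_single, nsmul_eq_mul,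
          mul_inv_cancel₀ hKl, ← MonoidAlgebra.one_def, one_smul]
      rw [this]
      refine Submodule.smul_mem _ _ ?_
      exact Submodule.subset_span ⟨l, rfl⟩
    exact hle (hspan ▸ Submodule.subset_span (Set.mem_range_self i))
  choose L hL w hw hLw using fun i => hlift u (hmem i)
  refine ⟨r, hr, u, hind, ∏ i, L i, Finset.prod_ne_zero_iff.2 fun i _ => hL i, fun v => ?_⟩
  have hle : Submodule.span (MonoidAlgebra ℤ G) (Set.range x) ≤
      (Submodule.span (MonoidAlgebra ℤ G) (Set.range u)).comap ((∏ i, L i) • LinearMap.id) := by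
    rw [Submodule.span_le]
    rintro _ ⟨i, rfl⟩
    have h1 : L i • x i = w i := hinj (by
      simp only [hLw, map_nsmul])
    rw [SetLike.mem_coe, Submodule.mem_comap, LinearMap.smul_apply, LinearMap.id_apply,
      ← Finset.prod_erase_mul _ _ (Finset.mem_univ i), mul_smul, h1]
    exact nsmul_mem (hw i) _
  exact hle (hx ▸ Submodule.mem_top)

/-- A member of a linearly independent family in a pure submodule of a free module becomes divisible
by `p` after transvections, if its span is not closed under division by `p`. -/
theorem exists_reflTransGen_step_eq_smul (hδ : 0 < δ) (hH : IsHyperbolic H δ) [Nonempty H]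
    (hdisp : ∀ g : G, g ≠ 1 → ∀ p : H, ρ < dist (g • p) p)
    (hρ : (4 * (r : ℝ) ^ 2 + 26 * r + 22) * δ ≤ ρ)
    (φ : N →ₗ[MonoidAlgebra ℤ G] (ι →₀ MonoidAlgebra ℤ G)) (hφ : Function.Injective φ)
    (hpure : ∀ p : ℕ, p ≠ 0 → ∀ v w, φ w = p • v → ∃ u, φ u = v) {y : Fin r → N} {p : ℕ}
    (hp : p.Prime) {w : N} (hw : w ∉ Submodule.span (MonoidAlgebra ℤ G) (Set.range y))
    (hpw : p • w ∈ Submodule.span (MonoidAlgebra ℤ G) (Set.range y)) :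
    ∃ x, Relation.ReflTransGen (Step (MonoidAlgebra ℤ G)) y x ∧ ∃ j z, x j = p • z := by
  have := Fact.mk hp
  let ψ : N →ₛₗ[coeffHom G (ZMod p)] (ι →₀ MonoidAlgebra (ZMod p) G) :=
    (reduce G ι (ZMod p)).comp φ
  -- If the family were independent mod `p`, all coefficients of `p • w` would be divisible by `p`,
  -- and cancelling `p` would put `w` in the span.
  have hdep : ¬LinearIndependent (MonoidAlgebra (ZMod p) G) (fun i => ψ (y i)) := by
    intro hli
    obtain ⟨c, hc⟩ := (Submodule.mem_span_range_iff_exists_fun _).1 hpw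
    rw [Fintype.linearIndependent_iff] at hli
    have hc0 := hli (fun i => coeffHom G (ZMod p) (c i)) (by
      have := congrArg ψ hc
      simp only [map_sum, map_smulₛₗ, map_nsmul] at this
      rw [this]
      ext i g
      rw [Finsupp.smul_apply, MonoidAlgebra.coeff_smul, Finsupp.smul_apply, nsmul_eq_mul,
        CharP.cast_eq_zero, zero_mul]
      rfl)
    choose b hb using fun i => exists_eq_smul_of_coeffHom_eq_zero (hc0 i)
    apply hw
    have : w = ∑ i, b i • y i := by
      apply hφ
      apply nsmul_right_injective hp.ne_zero
      change p • φ w = p • φ _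
      rw [← map_nsmul, ← map_nsmul, ← hc, Finset.smul_sum]
      congr 1
      refine Finset.sum_congr rfl fun i _ => ?_
      rw [hb, smul_assoc]
    rw [this]
    exact Submodule.sum_mem _ fun i _ => Submodule.smul_mem _ _ (Submodule.subset_span ⟨i, rfl⟩)
  obtain ⟨X, hX, j, hj⟩ := exists_reflTransGen_step_eq_zero hδ hH hdisp hρ _ hdep
  obtain ⟨x, hx, rfl⟩ := exists_lift_reflTransGen_step (R := MonoidAlgebra ℤ G)
    (S := MonoidAlgebra (ZMod p) G) (coeffHom_zmod_surjective p) ψ hX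
  -- Vanishing mod `p` gives a quotient by `p` in the free module only; purity moves it into `N`.
  obtain ⟨z, hz⟩ := exists_eq_smul_of_reduce_eq_zero hj
  obtain ⟨z, rfl⟩ := hpure p hp.ne_zero z _ hz
  exact ⟨x, hx, j, z, hφ (by rw [hz, map_nsmul])⟩

/-- A finitely generated module that embeds as a pure submodule in a free `ℤ[G]`-module is free. -/
theorem free_of_injective_of_pure (hδ : 0 < δ) (hH : IsHyperbolic H δ) [Nonempty H]
    (hdisp : ∀ g : G, g ≠ 1 → ∀ p : H, ρ < dist (g • p) p)
    (hρ : (4 * (n : ℝ) ^ 2 + 26 * n + 22) * δ ≤ ρ)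
    (φ : N →ₗ[MonoidAlgebra ℤ G] (ι →₀ MonoidAlgebra ℤ G)) (hφ : Function.Injective φ)
    (hpure : ∀ p : ℕ, p ≠ 0 → ∀ v w, φ w = p • v → ∃ u, φ u = v)
    {x : Fin n → N} (hx : Submodule.span (MonoidAlgebra ℤ G) (Set.range x) = ⊤) :
    Module.Free (MonoidAlgebra ℤ G) N := by
  obtain ⟨r, hr, y, hy, K, hK0, hK⟩ :=
    exists_linearIndependent_smul_mem_span hδ hH hdisp hρ φ hφ hx
  have hρ' : (4 * (r : ℝ) ^ 2 + 26 * r + 22) * δ ≤ ρ := le_trans (by gcongr) hρ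
  exact free_of_exists_division (R := MonoidAlgebra ℤ G) (MonoidAlgebra.lift ℤ ℤ G 1).toRingHom
    hy hK0 hK fun y _ p hp w hw hpw =>
      exists_reflTransGen_step_eq_smul hδ hH hdisp hρ' φ hφ hpure hp hw hpw

end Integral

end HypAct

theorem mainTheorem4 {G : Type*} [Group G] (n : ℕ) (δ : ℝ)
    -- the group `G` acts by isometries on a nonempty `δ`-hyperbolic space `H`
    {H : Type*} [MetricSpace H] [Nonempty H] [MulAction G H] [IsIsometricSMul G H]
    (hH : HypAct.IsHyperbolic H δ)
    -- with minimal displacement greater than `(2n+11)²δ`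
    (hdisp : ENNReal.ofReal ((2 * (n : ℝ) + 11) ^ 2 * δ) < HypAct.minimalDisplacement G H)
    -- `M` is an `n`-generated submodule of a free `ℤ[G]`-module `F`
    {F : Type*} [AddCommGroup F] [Module (MonoidAlgebra ℤ G) F] [Module.Free (MonoidAlgebra ℤ G) F]
    (M : Submodule (MonoidAlgebra ℤ G) F)
    (hgen : ∃ x : Fin n → F, Submodule.span (MonoidAlgebra ℤ G) (Set.range x) = M)
    -- whose quotient `F / M` is torsion-free as an abelian group
    (htf : IsAddTorsionFree (F ⧸ M)) :
    Module.Free (MonoidAlgebra ℤ G) M := by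
  -- A finite `ρ` is needed because the minimal displacement may be infinite. Enlarging `δ` to `ρ /
  -- (2n+11)²` makes it positive, as the descent requires even when `δ = 0`.
  obtain ⟨ρ, hρ, hρ'⟩ := ENNReal.lt_iff_exists_nnreal_btwn.1 hdisp
  have hρ0 : 0 < (ρ : ℝ) := NNReal.coe_pos.2 (ENNReal.coe_pos.1 (bot_le.trans_lt hρ))
  have hn : (0 : ℝ) < (2 * (n : ℝ) + 11) ^ 2 := by positivity
  have hδ : δ ≤ ρ / (2 * (n : ℝ) + 11) ^ 2 := by
    rw [le_div_iff₀' hn]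
    rw [← ENNReal.ofReal_coe_nnreal, ENNReal.ofReal_lt_ofReal_iff hρ0] at hρ
    exact hρ.le
  have hd : ∀ g : G, g ≠ 1 → ∀ p : H, (ρ : ℝ) < dist (g • p) p := by
    intro g hg p
    have h : (ρ : ENNReal) < edist (g • p) p :=
      hρ'.trans_le (iInf_le_of_le g (iInf_le_of_le hg (iInf_le _ p)))
    rw [edist_dist, ← ENNReal.ofReal_coe_nnreal] at h
    exact (ENNReal.ofReal_lt_ofReal_iff_of_nonneg hρ0.le).1 h
  obtain ⟨x, hx⟩ := hgen
  have hxM : ∀ i, x i ∈ M := fun i => hx ▸ Submodule.subset_span (Set.mem_range_self i)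
  let e := (Module.Free.chooseBasis (MonoidAlgebra ℤ G) F).repr
  refine HypAct.free_of_injective_of_pure (x := fun i => (⟨x i, hxM i⟩ : M)) (div_pos hρ0 hn)
    (hH.mono hδ) hd ?_ (e.toLinearMap.comp M.subtype) (e.injective.comp Subtype.val_injective) ?_ ?_
  · rw [mul_div_assoc', div_le_iff₀ hn, mul_comm]
    gcongr
    nlinarith [(Nat.cast_nonneg n : (0 : ℝ) ≤ n)]
  -- Torsion-freeness of `F ⧸ M` is purity: if `p • e.symm v` lies in `M`, so does `e.symm v`.
  · intro p hp v w hvw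
    have h1 : p • e.symm v = w := by
      apply e.injective
      rw [map_nsmul, e.apply_symm_apply]
      exact hvw.symm
    refine ⟨⟨e.symm v, ?_⟩, e.apply_symm_apply v⟩
    rw [← Submodule.Quotient.mk_eq_zero]
    refine nsmul_right_injective hp ?_
    change p • _ = p • (0 : F ⧸ M)
    rw [smul_zero, ← Submodule.Quotient.mk_smul, h1, Submodule.Quotient.mk_eq_zero]
    exact w.2
  · apply Submodule.map_injective_of_injective M.subtype_injective
    rw [Submodule.map_span, ← Set.range_comp, Submodule.map_subtype_top]
    exact hx
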